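/- Let $G$ be a finite group. For an irreducible complex character $\chi$ of $G$, the codegree of $\chi$ is $\mathrm{cod}(\chi)=|G:\ker\chi|/\chi(1)$, and $\mathrm{cod}(G)$ is the set of the codegrees of all irreducible complex characters of $G$. The codegree prime graph $\Delta_{\mathrm{cod}}(G)$ is the simple undirected graph whose vertices are the primes that divide some number in $\mathrm{cod}(G)$, two distinct vertices $p,q$ being adjacent if and only if $pq$ divides some number in $\mathrm{cod}(G)$. A group is metanilpotent if it has a nilpotent normal subgroup with nilpotent quotient. Let $\mathcal{C}$ be any class of finite groups such that every finite group of square-free order belongs to $\mathcal{C}$ and every group in $\mathcal{C}$ is metanilpotent. Let $F$ be a finite simple graph (possibly with no vertices). Then $F$ is isomorphic to $\Delta_{\mathrm{cod}}(G)$ for some $G\in\mathcal{C}$ if and only if the complement $\overline{F}$ of $F$ is bipartite, that is, 2-colorable. -/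

import Mathlib

universe u v

/-- A group is metanilpotent if it has a nilpotent normal subgroup with nilpotent quotient. -/
def IsMetanilpotent (G : Type u) [Group G] : Prop :=
  ∃ (N : Subgroup G) (_ : N.Normal), Group.IsNilpotent N ∧ Group.IsNilpotent (G ⧸ N)

/-- The codegree `|G : ker χ| / χ(1)` of the character `χ` afforded by a complex representation `ρ`,
as a rational number: `ker χ` is the kernel of `ρ` and `χ(1)` is the dimension of the
representation space. -/
noncomputable def codegree {G : Type u} [Group G] {V : Type} [AddCommGroup V] [Module ℂ V]
    (ρ : Representation ℂ G V) : ℚ :=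
  ((MonoidHom.ker ρ).index : ℚ) / (Module.finrank ℂ V : ℚ)

/-- The set `cod(G)` of the codegrees of the irreducible complex characters of a finite group `G`.
(They are natural numbers, since `χ(1)` divides `|G : ker χ|`. Every finite-dimensional complex
vector space is isomorphic to some `ℂⁿ`, so spaces in `Type` afford all irreducible characters.) -/
def codegrees (G : Type u) [Group G] : Set ℕ :=
  {n | ∃ (V : Type) (_ : AddCommGroup V) (_ : Module ℂ V) (_ : FiniteDimensional ℂ V)
      (ρ : Representation ℂ G V), ρ.IsIrreducible ∧ (n : ℚ) = codegree ρ}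

/-- The vertices of the codegree prime graph: the primes dividing some member of `cod(G)`. -/
abbrev CodegreePrime (G : Type u) [Group G] : Type :=
  {p : ℕ // p.Prime ∧ ∃ n ∈ codegrees G, p ∣ n}

/-- The codegree prime graph `Δ_cod(G)`: distinct primes `p`, `q` are adjacent if and only if
`p * q` divides some member of `cod(G)`. -/
def codegreePrimeGraph (G : Type u) [Group G] : SimpleGraph (CodegreePrime G) where
  Adj p q := p ≠ q ∧ ∃ n ∈ codegrees G, (p : ℕ) * (q : ℕ) ∣ n
  symm := ⟨fun p q h => ⟨h.1.symm, by simpa only [mul_comm] using h.2⟩⟩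
  loopless := ⟨fun _ h => h.1 rfl⟩

-- Let `N` be normal and nilpotent with `G ⧸ N` nilpotent, and colour each prime by whether it
-- divides `|G : N|`. Primes of the same colour are adjacent, because a linear character of a normal
-- Hall subgroup `M` has order dividing some codegree (`exists_mem_codegrees_of_normal_hall`). For
-- primes dividing `|G : N|`, take `M = G` and a character of the nilpotent quotient. For primes
-- `p`, `q` not dividing it, take the product of the Sylow `p`- and `q`-subgroups of `N`. A finite
-- nilpotent group has linear characters of order divisible by any two prime divisors of its order.
--
-- Conversely, a 2-colouring of the complement labels the vertices by distinct primes, those of one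
-- class being congruent to 1 modulo those of the other. Let `D a` and `C b` be cyclic of these
-- prime orders, and let `∏ D a` act on `∏ C b`, with `D a` trivial on `C b` for adjacent vertices
-- and fixed-point-free otherwise. The semidirect product has square-free order. A trivial action
-- gives a Hall subgroup mapping onto `C b × D a`, hence an edge. A fixed-point-free action forces
-- `|D a|` to divide the degree of every irreducible character nontrivial on `C b`; square-freeness
-- then forbids an edge.

universe w

/-! ### Irreducibility and transport of codegrees -/

section Irreducible

variable {G : Type u} [Group G] {V : Type w} [AddCommGroup V] [Module ℂ V]

theorem Representation.isIrreducible_iff_forall_submodule (ρ : Representation ℂ G V) :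
    ρ.IsIrreducible ↔ Nontrivial V ∧
      ∀ U : Submodule ℂ V, (∀ g, ∀ x ∈ U, ρ g x ∈ U) → U = ⊥ ∨ U = ⊤ := by
  constructor
  · intro h
    refine ⟨?_, fun U hU => ?_⟩
    · by_contra hV
      rw [not_nontrivial_iff_subsingleton] at hV
      refine (bot_ne_top : (⊥ : Subrepresentation ρ) ≠ ⊤) ?_
      exact Subrepresentation.toSubmodule_injective (Subsingleton.elim _ _)
    · rcases h.eq_bot_or_eq_top ⟨U, fun g x hx => hU g x hx⟩ with h | h
      · exact Or.inl (congrArg Subrepresentation.toSubmodule h)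
      · exact Or.inr (congrArg Subrepresentation.toSubmodule h)
  · rintro ⟨hV, h⟩
    have : Nontrivial (Subrepresentation ρ) :=
      ⟨⊥, ⊤, fun e => bot_ne_top (α := Submodule ℂ V) (congrArg Subrepresentation.toSubmodule e)⟩
    refine ⟨fun σ => ?_⟩
    rcases h σ.toSubmodule (fun g x hx => σ.apply_mem_toSubmodule g hx) with h | h
    · exact Or.inl (Subrepresentation.toSubmodule_injective h)
    · exact Or.inr (Subrepresentation.toSubmodule_injective h)

theorem Representation.isIrreducible_comp_of_surjective {H : Type v} [Group H]
    {ρ : Representation ℂ H V} (h : ρ.IsIrreducible) {f : G →* H} (hf : Function.Surjective f) :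
    Representation.IsIrreducible (MonoidHom.comp ρ f : Representation ℂ G V) := by
  rw [Representation.isIrreducible_iff_forall_submodule] at h ⊢
  refine ⟨h.1, fun U hU => h.2 U fun g x hx => ?_⟩
  obtain ⟨g, rfl⟩ := hf g
  exact hU g x hx

theorem codegrees_subset_of_surjective {H : Type v} [Group H] {f : G →* H}
    (hf : Function.Surjective f) : codegrees H ⊆ codegrees G := by
  rintro n ⟨V, _, _, _, ρ, hρ, hn⟩
  refine ⟨V, _, _, ‹_›, MonoidHom.comp ρ f, Representation.isIrreducible_comp_of_surjective hρ hf, ?_⟩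
  rw [hn, codegree, codegree, ← MonoidHom.comap_ker, Subgroup.index_comap_of_surjective _ hf]

theorem codegrees_eq_of_mulEquiv {H : Type v} [Group H] (e : G ≃* H) :
    codegrees G = codegrees H :=
  (codegrees_subset_of_surjective e.symm.surjective (f := e.symm.toMonoidHom)).antisymm
    (codegrees_subset_of_surjective e.surjective (f := e.toMonoidHom))

/-- Irreducible representations on spaces in any universe contribute to `codegrees`. -/
theorem mem_codegrees_of_mul_finrank_eq_index [FiniteDimensional ℂ V]
    {ρ : Representation ℂ G V} (hρ : ρ.IsIrreducible) {n : ℕ}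
    (hn : n * Module.finrank ℂ V = (MonoidHom.ker ρ).index) : n ∈ codegrees G := by
  let e : V ≃ₗ[ℂ] (Fin (Module.finrank ℂ V) → ℂ) := (Module.finBasis ℂ V).equivFun
  let σ : Representation ℂ G (Fin (Module.finrank ℂ V) → ℂ) :=
    (e.conjRingEquiv.toMonoidHom).comp ρ
  have hσ : ∀ g x, σ g x = e (ρ g (e.symm x)) := fun g x => rfl
  rw [Representation.isIrreducible_iff_forall_submodule] at hρ
  obtain ⟨hV, hU⟩ := hρ
  refine ⟨_, _, _, inferInstance, σ, ?_, ?_⟩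
  · rw [Representation.isIrreducible_iff_forall_submodule]
    refine ⟨e.symm.toEquiv.nontrivial, fun U h => ?_⟩
    have key := hU (U.comap e.toLinearMap) (fun g x hx => by
      have := h g _ hx
      simpa [hσ] using this)
    have hmap : (U.comap e.toLinearMap).map e.toLinearMap = U :=
      Submodule.map_comap_eq_of_surjective e.surjective U
    rcases key with h | h
    · left; rw [← hmap, h, Submodule.map_bot]
    · right; rw [← hmap, h, Submodule.map_top, LinearEquiv.range]
  · have hker : MonoidHom.ker σ = MonoidHom.ker ρ := by
      ext g
      exact e.conjRingEquiv.toMulEquiv.map_eq_one_iff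
    have h0 : (Module.finrank ℂ V : ℚ) ≠ 0 := by exact_mod_cast Module.finrank_pos.ne'
    rw [codegree, hker, ← hn, Module.finrank_fin_fun]
    push_cast
    field_simp

theorem exists_irreducible_of_mem_codegrees {n : ℕ} (hn : n ∈ codegrees G) :
    ∃ (V : Type) (_ : AddCommGroup V) (_ : Module ℂ V) (_ : FiniteDimensional ℂ V)
      (ρ : Representation ℂ G V), ρ.IsIrreducible ∧
        n * Module.finrank ℂ V = (MonoidHom.ker ρ).index := by
  obtain ⟨V, _, _, _, ρ, hρ, hn⟩ := hn
  refine ⟨V, _, _, ‹_›, ρ, hρ, ?_⟩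
  have := ((Representation.isIrreducible_iff_forall_submodule ρ).1 hρ).1
  have h0 : (Module.finrank ℂ V : ℚ) ≠ 0 := by exact_mod_cast Module.finrank_pos.ne'
  rw [codegree, eq_div_iff h0] at hn
  exact_mod_cast hn

theorem dvd_card_of_mem_codegrees {n : ℕ} (hn : n ∈ codegrees G) : n ∣ Nat.card G := by
  obtain ⟨V, _, _, _, ρ, -, h⟩ := exists_irreducible_of_mem_codegrees hn
  exact (Dvd.intro _ h).trans (Subgroup.index_dvd_card _)

end Irreducible

/-! ### Monomial representations and normal Hall subgroups -/

section Monomial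

open SemidirectProduct

variable {M : Type u} {H : Type v} [Group M] [Group H] {φ : H →* MulAut M}
  {I : Type w} [MulAction H I]

/-- The monomial representation of `M ⋊[φ] H` on functions on an `H`-set of linear characters
of `M`: it is induced from a linear character of the preimage of a point stabilizer. -/
def monomialRepresentation (φ : H →* MulAut M) (χ : I → M →* ℂˣ)
    (hχ : ∀ h i m, χ (h⁻¹ • i) m = χ i (φ h m)) :
    Representation ℂ (M ⋊[φ] H) (I → ℂ) where
  toFun s :=
    { toFun := fun f i => (χ i s.left : ℂ) * f (s.right⁻¹ • i)
      map_add' := fun f g => by ext i; simp [mul_add]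
      map_smul' := fun c f => by ext i; simp [mul_left_comm] }
  map_one' := by ext; simp
  map_mul' s t := by
    refine LinearMap.ext fun f => funext fun i => ?_
    simp [hχ, mul_smul, mul_assoc]

theorem monomialRepresentation_apply (χ : I → M →* ℂˣ)
    (hχ : ∀ h i m, χ (h⁻¹ • i) m = χ i (φ h m)) (s : M ⋊[φ] H) (f : I → ℂ) (i : I) :
    monomialRepresentation φ χ hχ s f i = (χ i s.left : ℂ) * f (s.right⁻¹ • i) := rfl

/-- Since the characters `χ i` are distinct, orthogonality shows that averaging over `M` against the
inverse of `χ i` projects onto the line of the delta function at `i`. A nonzero invariant subspace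
thus contains one delta function, and by transitivity of `H` all of them. -/
theorem monomialRepresentation_isIrreducible [Finite M] [Finite I] [Nonempty I]
    [MulAction.IsPretransitive H I] (χ : I → M →* ℂˣ) (hinj : Function.Injective χ)
    (hχ : ∀ h i m, χ (h⁻¹ • i) m = χ i (φ h m)) :
    (monomialRepresentation φ χ hχ).IsIrreducible := by
  classical
  have := Fintype.ofFinite M
  have := Fintype.ofFinite I
  rw [Representation.isIrreducible_iff_forall_submodule]
  refine ⟨inferInstance, fun U hU => ?_⟩
  rw [or_iff_not_imp_left]
  intro hne
  obtain ⟨f, hf, hf0⟩ := U.exists_mem_ne_zero_of_ne_bot hne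
  obtain ⟨i, hi⟩ := Function.ne_iff.1 hf0
  have hsum : ∀ j, ∑ m : M, (((χ i m)⁻¹ * χ j m : ℂˣ) : ℂ) =
      if j = i then (Fintype.card M : ℂ) else 0 := by
    intro j
    have := sum_hom_units ((Units.coeHom ℂ).comp ((χ i)⁻¹ * χ j))
    simp only [MonoidHom.comp_apply, MonoidHom.mul_apply, MonoidHom.inv_apply,
      Units.coeHom_apply] at this
    rw [this]
    have hiff : ((Units.coeHom ℂ).comp ((χ i)⁻¹ * χ j) = 1) ↔ j = i := by
      constructor
      · intro h
        refine hinj (MonoidHom.ext fun m => ?_)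
        have := DFunLike.congr_fun h m
        simp only [MonoidHom.comp_apply, MonoidHom.mul_apply, MonoidHom.inv_apply,
          Units.coeHom_apply, MonoidHom.one_apply, Units.val_eq_one] at this
        exact (inv_mul_eq_one.1 this).symm
      · rintro rfl
        ext m; simp
    simp [hiff]
  have hcard : (Fintype.card M : ℂ) ≠ 0 := by exact_mod_cast Fintype.card_ne_zero
  have hmem : (Pi.single i 1 : I → ℂ) ∈ U := by
    have h1 : ∑ m : M, (((χ i m)⁻¹ : ℂˣ) : ℂ) • monomialRepresentation φ χ hχ (inl m) f ∈ U :=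
      U.sum_mem fun m _ => U.smul_mem _ (hU _ _ hf)
    have h2 : ∑ m : M, (((χ i m)⁻¹ : ℂˣ) : ℂ) • monomialRepresentation φ χ hχ (inl m) f =
        ((Fintype.card M : ℂ) * f i) • Pi.single i 1 := by
      ext j
      simp only [Finset.sum_apply, Pi.smul_apply, monomialRepresentation_apply, left_inl,
        right_inl, inv_one, one_smul, smul_eq_mul, ← mul_assoc, ← Units.val_mul]
      rw [← Finset.sum_mul, hsum]
      by_cases h : j = i
      · subst h; simp
      · simp [h]
    rw [h2] at h1
    exact (U.smul_mem_iff (mul_ne_zero hcard hi)).1 h1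
  have hall : ∀ j, (Pi.single j 1 : I → ℂ) ∈ U := by
    intro j
    obtain ⟨h, rfl⟩ := MulAction.exists_smul_eq H i j
    have := hU (inr h) _ hmem
    convert this using 1
    ext k
    rw [monomialRepresentation_apply]
    simp [Pi.single_apply, inv_smul_eq_iff]
  rw [eq_top_iff]
  intro x _
  rw [← Finset.univ_sum_single x]
  refine U.sum_mem fun j _ => ?_
  have := U.smul_mem (x j) (hall j)
  rwa [← Pi.single_smul, smul_eq_mul, mul_one] at this

/-- The character is the monomial one on the `H`-orbit of `χ`. Its degree, the orbit length, divides
`|H|` and so is coprime to the order of `χ`, which divides `|M|`. Dividing the index of the kernel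
by the degree therefore keeps the factor `orderOf χ`. -/
theorem exists_mem_codegrees_semidirectProduct [Finite M] [Finite H]
    (hcop : (Nat.card M).Coprime (Nat.card H)) (χ : M →* ℂˣ) :
    ∃ n ∈ codegrees (M ⋊[φ] H), orderOf χ ∣ n := by
  classical
  let : MulAction H (M →* ℂˣ) :=
    { smul := fun h μ => μ.comp (φ h⁻¹).toMonoidHom
      one_smul := fun μ => by
        change μ.comp (φ 1⁻¹).toMonoidHom = μ
        ext; simp
      mul_smul := fun g h μ => by
        change μ.comp (φ (g * h)⁻¹).toMonoidHom =
          (μ.comp (φ h⁻¹).toMonoidHom).comp (φ g⁻¹).toMonoidHom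
        ext; simp }
  have hsmul : ∀ (h : H) (μ : M →* ℂˣ) (m : M), (h⁻¹ • μ) m = μ (φ h m) := fun h μ m => by
    change μ (φ h⁻¹⁻¹ m) = _
    rw [inv_inv]
  let I := MulAction.orbit H χ
  have : Finite I := Set.finite_range _
  let c : I → M →* ℂˣ := fun i => i.1
  have hc : ∀ (h : H) (i : I) (m : M), c (h⁻¹ • i) m = c i (φ h m) := fun h i m => hsmul h i.1 m
  let i₀ : I := ⟨χ, MulAction.mem_orbit_self χ⟩
  have : Nonempty I := ⟨i₀⟩
  have hirr := monomialRepresentation_isIrreducible c Subtype.val_injective hc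
  set ρ := monomialRepresentation φ c hc with hρ
  have hidx : (MulAction.stabilizer H i₀).index = Nat.card I :=
    MulAction.index_stabilizer_of_transitive H i₀
  -- An element of the kernel fixes the delta function at `i₀`, so its `H`-part fixes `i₀`. Hence
  -- the degree divides the index of the kernel.
  have hle : MonoidHom.ker ρ ≤ (MulAction.stabilizer H i₀).comap rightHom := by
    intro s hs
    rw [MonoidHom.mem_ker] at hs
    have h1 : ρ s (Pi.single i₀ 1) i₀ = 1 := by rw [hs]; simp
    rw [hρ, monomialRepresentation_apply] at h1
    rw [Subgroup.mem_comap, MulAction.mem_stabilizer_iff, rightHom_eq_right]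
    by_contra hne
    rw [Pi.single_eq_of_ne (fun h => hne (inv_smul_eq_iff.1 h).symm)] at h1
    simp at h1
  have hdvd : Nat.card I ∣ (MonoidHom.ker ρ).index := by
    have := Subgroup.index_dvd_of_le hle
    rwa [Subgroup.index_comap_of_surjective _ rightHom_surjective, hidx] at this
  obtain ⟨n, hn⟩ := hdvd
  have hord : orderOf χ ∣ (MonoidHom.ker ρ).index := by
    refine orderOf_dvd_of_pow_eq_one (MonoidHom.ext fun m => ?_)
    have hmem := Subgroup.pow_index_mem (MonoidHom.ker ρ) (inl m : M ⋊[φ] H)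
    rw [MonoidHom.mem_ker, ← map_pow] at hmem
    have h1 : ρ (inl (m ^ (MonoidHom.ker ρ).index)) (Pi.single i₀ 1) i₀ = 1 := by
      rw [hmem]; simp
    rw [hρ, monomialRepresentation_apply] at h1
    rw [left_inl, right_inl, inv_one, one_smul, Pi.single_eq_same, mul_one, map_pow] at h1
    exact Units.val_eq_one.1 h1
  have hordM : orderOf χ ∣ Nat.card M := by
    refine orderOf_dvd_of_pow_eq_one (MonoidHom.ext fun m => ?_)
    rw [MonoidHom.pow_apply, ← map_pow, pow_card_eq_one', map_one, MonoidHom.one_apply]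
  have hIH : Nat.card I ∣ Nat.card H := hidx ▸ Subgroup.index_dvd_card _
  refine ⟨n, mem_codegrees_of_mul_finrank_eq_index hirr ?_, ?_⟩
  · have := Fintype.ofFinite I
    rw [Module.finrank_fintype_fun_eq_card, hn, mul_comm, Nat.card_eq_fintype_card]
  · rw [hn] at hord
    exact ((hcop.coprime_dvd_left hordM).coprime_dvd_right hIH).dvd_of_dvd_mul_left hord

end Monomial

/-- A linear character of a normal Hall subgroup has order dividing some codegree. -/
theorem exists_mem_codegrees_of_normal_hall {G : Type u} [Group G] [Finite G] (M : Subgroup G)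
    [M.Normal] (hM : (Nat.card M).Coprime M.index) (χ : M →* ℂˣ) :
    ∃ n ∈ codegrees G, orderOf χ ∣ n := by
  -- Schur–Zassenhaus reduces the claim to a semidirect product.
  obtain ⟨K, hK⟩ := Subgroup.exists_right_complement'_of_coprime hM
  rw [← codegrees_eq_of_mulEquiv (SemidirectProduct.mulEquivSubgroup hK)]
  refine exists_mem_codegrees_semidirectProduct ?_ χ
  rwa [← hK.symm.index_eq_card]

/-! ### Linear characters of nilpotent groups -/

section Nilpotent

/-- The linear characters of a finite nilpotent group include one of each prime order dividing the
order of the group. -/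
theorem exists_linear_character_orderOf_eq {A : Type u} [Group A] [Finite A] [Group.IsNilpotent A]
    {p : ℕ} (hp : p.Prime) (hpA : p ∣ Nat.card A) : ∃ χ : A →* ℂˣ, orderOf χ = p := by
  have : Fact p.Prime := ⟨hp⟩
  -- Nilpotency makes `A` the product of its Sylow subgroups, so `A` maps onto a nontrivial
  -- `p`-group and onto its abelianization, also nontrivial by solvability. The dual of the latter
  -- has the same order, so Cauchy's theorem gives a character of order `p`.
  obtain ⟨e⟩ := ((Group.isNilpotent_of_finite_tfae (G := A)).out 0 4).1 ‹_›
  let P : Sylow p A := default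
  let p' : (Nat.card A).primeFactors := ⟨p, Nat.mem_primeFactors.2 ⟨hp, hpA, Nat.card_pos.ne'⟩⟩
  let π₀ : (∀ p : (Nat.card A).primeFactors, ∀ P : Sylow p A, (↑P : Subgroup A)) →* P :=
    { toFun := fun x => x p' P
      map_one' := rfl
      map_mul' := fun _ _ => rfl }
  have hπ₀ : Function.Surjective π₀ := by
    classical
    intro x
    refine ⟨Function.update 1 p' (Function.update 1 P x), ?_⟩
    change Function.update (1 : ∀ p : (Nat.card A).primeFactors,
      ∀ P : Sylow p A, (↑P : Subgroup A)) p' (Function.update 1 P x) p' P = x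
    rw [Function.update_self, Function.update_self]
  let π : A →* Abelianization P := Abelianization.of.comp (π₀.comp e.symm.toMonoidHom)
  have hπ : Function.Surjective π :=
    (QuotientGroup.mk'_surjective _).comp (hπ₀.comp e.symm.surjective)
  have : Group.IsNilpotent P := P.isPGroup'.isNilpotent
  have : Nontrivial P := by
    rw [← Finite.one_lt_card_iff_nontrivial]
    exact hp.one_lt.trans_le (Nat.le_of_dvd Nat.card_pos (P.dvd_card_of_dvd_card hpA))
  have hlt := Group.IsSolvable.commutator_lt_top_of_nontrivial P
  have hP : IsPGroup p (Abelianization P) := P.isPGroup'.to_quotient _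
  have : Nontrivial (Abelianization P) := QuotientGroup.nontrivial_iff.2 hlt.ne
  have hdvd : p ∣ Nat.card (Abelianization P →* ℂˣ) := by
    rw [CommGroup.card_monoidHom_of_hasEnoughRootsOfUnity]
    obtain ⟨n, hn, hc⟩ := hP.nontrivial_iff_card.1 ‹_›
    rw [hc]
    exact dvd_pow_self p hn.ne'
  have : Finite (Abelianization P →* ℂˣ) :=
    Nat.finite_of_card_ne_zero (by
      rw [CommGroup.card_monoidHom_of_hasEnoughRootsOfUnity]; exact Nat.card_pos.ne')
  obtain ⟨χ, hχ⟩ := exists_prime_orderOf_dvd_card' p hdvd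
  refine ⟨χ.comp π, Eq.trans ?_ hχ⟩
  exact orderOf_injective (MonoidHom.compHom' π : (Abelianization P →* ℂˣ) →* (A →* ℂˣ))
    (fun a b h => (MonoidHom.cancel_right hπ).1 h) χ

theorem exists_linear_character_dvd_orderOf {A : Type u} [Group A] [Finite A]
    [Group.IsNilpotent A] {p q : ℕ} (hp : p.Prime) (hq : q.Prime) (hpA : p ∣ Nat.card A)
    (hqA : q ∣ Nat.card A) : ∃ χ : A →* ℂˣ, p ∣ orderOf χ ∧ q ∣ orderOf χ := by
  obtain ⟨χ, hχ⟩ := exists_linear_character_orderOf_eq hp hpA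
  obtain ⟨ψ, hψ⟩ := exists_linear_character_orderOf_eq hq hqA
  rcases eq_or_ne p q with rfl | hne
  · exact ⟨χ, by rw [hχ], by rw [hχ]⟩
  · have := (Commute.all χ ψ).orderOf_mul_eq_mul_orderOf_of_coprime
      (by rw [hχ, hψ]; exact (Nat.coprime_primes hp hq).2 hne)
    refine ⟨χ * ψ, ?_, ?_⟩
    · rw [this, hχ]; exact dvd_mul_right _ _
    · rw [this, hψ]; exact dvd_mul_left _ _

end Nilpotent

/-! ### Primes of the same colour are adjacent -/

section Adjacency

theorem codegreePrimeGraph_adj_of_dvd {G : Type u} [Group G] {x y : CodegreePrime G} (hne : x ≠ y)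
    (h : ∃ n ∈ codegrees G, (x : ℕ) ∣ n ∧ (y : ℕ) ∣ n) : (codegreePrimeGraph G).Adj x y := by
  obtain ⟨n, hn, hx, hy⟩ := h
  exact ⟨hne, n, hn, ((Nat.coprime_primes x.2.1 y.2.1).2
    (fun e => hne (Subtype.ext e))).mul_dvd_of_dvd_of_dvd hx hy⟩

variable {G : Type u} [Group G] [Finite G] {p q : ℕ}

theorem exists_mem_codegrees_of_nilpotent_quotient_of_hall (M : Subgroup G) [M.Normal]
    (hM : (Nat.card M).Coprime M.index) {A : Type v} [Group A] [Finite A] [Group.IsNilpotent A]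
    {f : M →* A} (hf : Function.Surjective f) (hp : p.Prime) (hq : q.Prime)
    (hpA : p ∣ Nat.card A) (hqA : q ∣ Nat.card A) : ∃ n ∈ codegrees G, p ∣ n ∧ q ∣ n := by
  obtain ⟨χ, hχp, hχq⟩ := exists_linear_character_dvd_orderOf hp hq hpA hqA
  obtain ⟨n, hn, h⟩ := exists_mem_codegrees_of_normal_hall M hM (χ.comp f)
  have : orderOf (χ.comp f) = orderOf χ :=
    orderOf_injective (MonoidHom.compHom' f : (A →* ℂˣ) →* (M →* ℂˣ))
      (fun a b h => (MonoidHom.cancel_right hf).1 h) χ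
  rw [this] at h
  exact ⟨n, hn, hχp.trans h, hχq.trans h⟩

theorem exists_mem_codegrees_of_dvd_index (N : Subgroup G) [N.Normal] [Group.IsNilpotent (G ⧸ N)]
    (hp : p.Prime) (hq : q.Prime) (hpN : p ∣ N.index) (hqN : q ∣ N.index) :
    ∃ n ∈ codegrees G, p ∣ n ∧ q ∣ n := by
  refine exists_mem_codegrees_of_nilpotent_quotient_of_hall (⊤ : Subgroup G) (by simp)
    (f := (QuotientGroup.mk' N).comp (⊤ : Subgroup G).subtype) ?_ hp hq hpN hqN
  refine (QuotientGroup.mk'_surjective N).comp ?_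
  intro x
  exact ⟨⟨x, trivial⟩, rfl⟩

theorem Subgroup.card_sup_dvd_mul_card {G : Type u} [Group G] (H K : Subgroup G) [K.Normal] :
    Nat.card (H ⊔ K : Subgroup G) ∣ Nat.card H * Nat.card K := by
  rw [← Subgroup.relIndex_bot_left (H ⊔ K),
    ← Subgroup.relIndex_mul_relIndex ⊥ K (H ⊔ K) bot_le le_sup_right, Subgroup.relIndex_sup_right,
    Subgroup.relIndex_bot_left, mul_comm]
  exact mul_dvd_mul_right (Subgroup.relIndex_dvd_card _ _) _

/-- The Sylow subgroups `P`, `Q` of `N` are characteristic in `N`, hence normal in `G`, and are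
Sylow in `G` because `p` and `q` do not divide `|G : N|`. Their product is a nilpotent normal Hall
subgroup. The case `p = q` is allowed; it shows that a single prime is a vertex. -/
theorem exists_mem_codegrees_of_not_dvd_index (N : Subgroup G) [N.Normal] [Group.IsNilpotent N]
    (hp : p.Prime) (hq : q.Prime) (hpG : p ∣ Nat.card G) (hqG : q ∣ Nat.card G)
    (hpN : ¬ p ∣ N.index) (hqN : ¬ q ∣ N.index) : ∃ n ∈ codegrees G, p ∣ n ∧ q ∣ n := by
  have : Fact p.Prime := ⟨hp⟩
  have : Fact q.Prime := ⟨hq⟩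
  rw [← N.card_mul_index] at hpG hqG
  replace hpG := (hp.dvd_mul.1 hpG).resolve_right hpN
  replace hqG := (hq.dvd_mul.1 hqG).resolve_right hqN
  let P : Sylow p N := default
  let Q : Sylow q N := default
  have hPc : (P : Subgroup N).Characteristic := P.characteristic_of_normal inferInstance
  have hQc : (Q : Subgroup N).Characteristic := Q.characteristic_of_normal inferInstance
  let M : Subgroup G := ((P : Subgroup N) ⊔ Q).map N.subtype
  have hMnormal : M.Normal := by
    have h : M = (P : Subgroup N).map N.subtype ⊔ (Q : Subgroup N).map N.subtype :=
      Subgroup.map_sup _ _ _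
    have := ConjAct.normal_of_characteristic_of_normal (H := N) (K := (P : Subgroup N))
    have := ConjAct.normal_of_characteristic_of_normal (H := N) (K := (Q : Subgroup N))
    rw [h]
    exact Subgroup.sup_normal _ _
  let e : ((P : Subgroup N) ⊔ Q : Subgroup N) ≃* M :=
    Subgroup.equivMapOfInjective _ _ N.subtype_injective
  have hcard : Nat.card ((P : Subgroup N) ⊔ Q : Subgroup N) = Nat.card M := Nat.card_congr e.toEquiv
  have hpM : ¬ p ∣ M.index := by
    rw [Subgroup.index_map_subtype]
    refine fun h => (hp.dvd_mul.1 h).elim (fun h => P.not_dvd_index ?_) hpN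
    exact h.trans (Subgroup.index_dvd_of_le le_sup_left)
  have hqM : ¬ q ∣ M.index := by
    rw [Subgroup.index_map_subtype]
    refine fun h => (hq.dvd_mul.1 h).elim (fun h => Q.not_dvd_index ?_) hqN
    exact h.trans (Subgroup.index_dvd_of_le le_sup_right)
  have hcop : (Nat.card M).Coprime M.index := by
    refine Nat.coprime_of_dvd fun r hr hrM hri => ?_
    rw [← hcard] at hrM
    rcases hr.dvd_mul.1 (hrM.trans (Subgroup.card_sup_dvd_mul_card _ _)) with h | h
    · obtain ⟨k, hk⟩ := P.isPGroup'.exists_card_eq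
      rw [hk] at h
      exact hpM ((Nat.prime_dvd_prime_iff_eq hr hp).1 (hr.dvd_of_dvd_pow h) ▸ hri)
    · obtain ⟨k, hk⟩ := Q.isPGroup'.exists_card_eq
      rw [hk] at h
      exact hqM ((Nat.prime_dvd_prime_iff_eq hr hq).1 (hr.dvd_of_dvd_pow h) ▸ hri)
  refine exists_mem_codegrees_of_nilpotent_quotient_of_hall M hcop e.symm.surjective
    (f := e.symm.toMonoidHom) hp hq ?_ ?_
  · exact (P.dvd_card_of_dvd_card hpG).trans (Subgroup.card_dvd_of_le le_sup_left)
  · exact (Q.dvd_card_of_dvd_card hqG).trans (Subgroup.card_dvd_of_le le_sup_right)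

theorem compl_codegreePrimeGraph_isBipartite (hG : IsMetanilpotent G) :
    (codegreePrimeGraph G)ᶜ.IsBipartite := by
  classical
  obtain ⟨N, hN, hnil, hquot⟩ := hG
  have hcard : ∀ x : CodegreePrime G, (x : ℕ) ∣ Nat.card G := fun x => by
    obtain ⟨n, hn, h⟩ := x.2.2
    exact h.trans (dvd_card_of_mem_codegrees hn)
  refine ⟨SimpleGraph.Coloring.mk (fun x => if (x : ℕ) ∣ N.index then 0 else 1) ?_⟩
  intro x y hxy hc
  rw [SimpleGraph.compl_adj] at hxy
  refine hxy.2 (codegreePrimeGraph_adj_of_dvd hxy.1 ?_)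
  by_cases hx : (x : ℕ) ∣ N.index <;> by_cases hy : (y : ℕ) ∣ N.index
  · exact exists_mem_codegrees_of_dvd_index N x.2.1 y.2.1 hx hy
  · simp [hx, hy] at hc
  · simp [hx, hy] at hc
  · exact exists_mem_codegrees_of_not_dvd_index N x.2.1 y.2.1 (hcard x) (hcard y) hx hy

end Adjacency

/-! ### Fixed-point-free action and character degrees -/

section Frobenius

variable {G : Type u} [Group G] [Finite G] {V : Type w} [AddCommGroup V] [Module ℂ V]

/-- The sum is a `Q`-invariant vector, and the `Q`-invariants form a subrepresentation because `Q`
is normal; by irreducibility it is zero or everything. -/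
theorem Representation.sum_apply_eq_zero_of_not_le_ker {G : Type u} [Group G] {V : Type w}
    [AddCommGroup V] [Module ℂ V] {ρ : Representation ℂ G V}
    (hρ : ρ.IsIrreducible) (Q : Subgroup G) [Q.Normal] [Fintype Q]
    (hQ : ¬ Q ≤ MonoidHom.ker ρ) (v : V) : ∑ x : Q, ρ x v = 0 := by
  rw [Representation.isIrreducible_iff_forall_submodule] at hρ
  let σ : Representation ℂ Q V := MonoidHom.comp ρ Q.subtype
  have hU : ∀ g, ∀ x ∈ σ.invariants, ρ g x ∈ σ.invariants := by
    intro g x hx y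
    have hy : g⁻¹ * y * g ∈ Q := by
      simpa using ‹Q.Normal›.conj_mem y y.2 g⁻¹
    have h1 : ρ (g⁻¹ * y * g) x = x := hx ⟨_, hy⟩
    calc ρ y (ρ g x) = ρ g (ρ (g⁻¹ * y * g) x) := by
          rw [← Module.End.mul_apply, ← Module.End.mul_apply, ← map_mul, ← map_mul]
          congr 2
          group
      _ = ρ g x := by rw [h1]
  have hmem : ∑ x : Q, ρ x v ∈ σ.invariants := by
    intro y
    change ρ y (∑ x : Q, ρ x v) = _
    rw [map_sum]
    refine Fintype.sum_equiv (Equiv.mulLeft y) _ _ fun x => ?_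
    rw [← Module.End.mul_apply, ← map_mul]
    rfl
  rcases hρ.2 _ hU with h | h
  · rw [h] at hmem
    exact (Submodule.mem_bot ℂ).1 hmem
  · refine absurd (fun x hx => ?_) hQ
    rw [MonoidHom.mem_ker]
    refine LinearMap.ext fun w => ?_
    have hw : w ∈ σ.invariants := h ▸ Submodule.mem_top
    exact hw ⟨x, hx⟩

/-- As `g` centralizes no nontrivial element of `Q`, the map sending `x` to the commutator `x g x⁻¹
g⁻¹` permutes `Q`. So `y g` runs over conjugates of `g` as `y` runs over `Q`, and `|Q|` times the
trace of `ρ g` is the trace of `(∑ y, ρ y) * ρ g`, which vanishes. -/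
theorem Representation.trace_eq_zero_of_commute_imp_eq_one
    {ρ : Representation ℂ G V} (hρ : ρ.IsIrreducible) (Q : Subgroup G) [Q.Normal]
    (hQ : ¬ Q ≤ MonoidHom.ker ρ) {g : G} (hg : ∀ x ∈ Q, g * x = x * g → x = 1) :
    LinearMap.trace ℂ V (ρ g) = 0 := by
  have := Fintype.ofFinite Q
  let c : Q → Q := fun x => ⟨x * (g * x⁻¹ * g⁻¹), Q.mul_mem x.2
    (‹Q.Normal›.conj_mem _ (Q.inv_mem x.2) g)⟩
  have hc : Function.Bijective c := by
    rw [← Finite.injective_iff_bijective]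
    intro x y h
    have h1 : (x : G) * (g * (x : G)⁻¹ * g⁻¹) = y * (g * (y : G)⁻¹ * g⁻¹) := congrArg Subtype.val h
    have h2 := hg ((y : G)⁻¹ * x) (Q.mul_mem (Q.inv_mem y.2) x.2) (by
      have h3 : (x : G) * g * (x : G)⁻¹ = y * g * (y : G)⁻¹ := by
        simpa [← mul_assoc] using h1
      calc g * ((y : G)⁻¹ * x) = (y : G)⁻¹ * (y * g * (y : G)⁻¹) * x := by group
        _ = (y : G)⁻¹ * x * g := by rw [← h3]; group)
    exact Subtype.ext (inv_mul_eq_one.1 h2).symm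
  have hterm : ∀ x : Q, LinearMap.trace ℂ V (ρ (c x) * ρ g) = LinearMap.trace ℂ V (ρ g) := by
    intro x
    have h1 : ρ (c x) * ρ g = ρ x * (ρ g * ρ (x : G)⁻¹) := by
      rw [← map_mul, ← map_mul, ← map_mul]
      congr 1
      simp [c, mul_assoc]
    rw [h1, LinearMap.trace_mul_comm, mul_assoc, ← map_mul, inv_mul_cancel, map_one, mul_one]
  have hzero : ∑ x : Q, ρ x = 0 := by
    refine LinearMap.ext fun v => ?_
    rw [LinearMap.sum_apply]
    exact ρ.sum_apply_eq_zero_of_not_le_ker hρ Q hQ v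
  have hsum : ∑ x : Q, LinearMap.trace ℂ V (ρ (c x) * ρ g) = 0 := by
    rw [hc.sum_comp fun y : Q => LinearMap.trace ℂ V (ρ y * ρ g), ← map_sum, ← Finset.sum_mul,
      hzero, zero_mul, map_zero]
  simp only [hterm, Finset.sum_const, Finset.card_univ, nsmul_eq_mul] at hsum
  exact (mul_eq_zero.1 hsum).resolve_left (by exact_mod_cast Fintype.card_ne_zero)

/-- The dimension of the invariants is the trace of the averaging projection, here `dim V / |P|`. -/
theorem Representation.card_dvd_finrank_of_trace_eq_zero {P : Type v} [Group P] [Finite P]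
    [FiniteDimensional ℂ V] (σ : Representation ℂ P V)
    (h : ∀ g, g ≠ 1 → LinearMap.trace ℂ V (σ g) = 0) : Nat.card P ∣ Module.finrank ℂ V := by
  classical
  have := Fintype.ofFinite P
  have hP : (Fintype.card P : ℂ) ≠ 0 := by exact_mod_cast Fintype.card_ne_zero
  let := invertibleOfNonzero hP
  have h1 := σ.isProj_averageMap.trace
  have h2 : LinearMap.trace ℂ V σ.averageMap =
      (Fintype.card P : ℂ)⁻¹ * Module.finrank ℂ V := by
    simp only [Representation.averageMap, GroupAlgebra.average, map_smul, map_sum,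
      MonoidAlgebra.of_apply, Representation.asAlgebraHom_single, one_smul, smul_eq_mul, invOf_eq_inv]
    rw [Finset.sum_eq_single 1 (fun g _ hg => h g hg) (by simp), map_one, LinearMap.trace_one]
  rw [h2, inv_mul_eq_iff_eq_mul₀ hP] at h1
  rw [Nat.card_eq_fintype_card]
  exact ⟨_, by exact_mod_cast h1⟩

/-- If `P` acts without fixed points on the normal subgroup `Q`, then `|P|` divides the degree of
every irreducible character whose kernel does not contain `Q`. -/
theorem Representation.card_dvd_finrank_of_commute_imp_eq_one [FiniteDimensional ℂ V]
    {ρ : Representation ℂ G V} (hρ : ρ.IsIrreducible) (Q : Subgroup G) [Q.Normal]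
    (hQ : ¬ Q ≤ MonoidHom.ker ρ) (P : Subgroup G)
    (hPQ : ∀ g ∈ P, g ≠ 1 → ∀ x ∈ Q, g * x = x * g → x = 1) :
    Nat.card P ∣ Module.finrank ℂ V :=
  Representation.card_dvd_finrank_of_trace_eq_zero (MonoidHom.comp ρ P.subtype : Representation ℂ P V)
    fun g hg => Representation.trace_eq_zero_of_commute_imp_eq_one hρ Q hQ
      (hPQ g g.2 fun h => hg (Subtype.ext h))

/-- Suppose both primes divide the codegree. If `Q` lies in the kernel, `|Q|²` divides `|G|`, once
from the kernel and once from its index. Otherwise `|P|` divides both the degree and the codegree,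
so `|P|²` divides `|G|`. -/
theorem not_dvd_of_mem_codegrees_of_commute_imp_eq_one (hG : Squarefree (Nat.card G))
    (P Q : Subgroup G) [Q.Normal] (hP : (Nat.card P).Prime) (hQ : (Nat.card Q).Prime)
    (hPQ : ∀ g ∈ P, g ≠ 1 → ∀ x ∈ Q, g * x = x * g → x = 1) {n : ℕ} (hn : n ∈ codegrees G)
    (hPn : Nat.card P ∣ n) : ¬ Nat.card Q ∣ n := by
  intro hQn
  obtain ⟨V, _, _, _, ρ, hρ, h⟩ := exists_irreducible_of_mem_codegrees hn
  by_cases hker : Q ≤ MonoidHom.ker ρ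
  · have h1 : Nat.card Q * Nat.card Q ∣ Nat.card G := by
      rw [← (MonoidHom.ker ρ).card_mul_index]
      exact mul_dvd_mul (Subgroup.card_dvd_of_le hker) (hQn.trans (Dvd.intro _ h))
    exact hQ.not_isUnit (hG _ h1)
  · have h1 := Representation.card_dvd_finrank_of_commute_imp_eq_one hρ Q hker P hPQ
    have h2 : Nat.card P * Nat.card P ∣ Nat.card G :=
      (mul_dvd_mul hPn h1).trans (h ▸ Subgroup.index_dvd_card _)
    exact hP.not_isUnit (hG _ h2)

end Frobenius

/-! ### Semidirect products with a diagonal action -/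

section DiagonalAction

open SemidirectProduct

variable {A B : Type} {C U : B → Type} {D : A → Type} [∀ b, CommGroup (C b)]
  [∀ b, CommGroup (U b)] [∀ a, CommGroup (D a)]

/-- The coordinatewise action on `∏ b, C b` of a group acting on each `C b` through `U b`. -/
def piAction {H : Type} [Group H] (α : ∀ b, U b →* MulAut (C b)) (ψ : ∀ b, H →* U b) :
    H →* MulAut (∀ b, C b) where
  toFun h := MulEquiv.piCongrRight fun b => α b (ψ b h)
  map_one' := by ext; simp
  map_mul' g h := by ext; simp

/-- The action of `∏ a, D a` on `∏ b, C b` in which each `D a` acts on `C b` through `θ a b`. -/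
def diagonalAction [Fintype A] (α : ∀ b, U b →* MulAut (C b)) (θ : ∀ a b, D a →* U b) :
    (∀ a, D a) →* MulAut (∀ b, C b) :=
  piAction α fun b => ∏ a, (θ a b).comp (Pi.evalMonoidHom D a)

theorem diagonalAction_mulSingle_apply [Fintype A] [DecidableEq A]
    (α : ∀ b, U b →* MulAut (C b)) (θ : ∀ a b, D a →* U b) (a : A) (y : D a)
    (x : ∀ b, C b) (b : B) :
    diagonalAction α θ (Pi.mulSingle a y) x b = α b (θ a b y) (x b) := by
  change α b ((∏ a', (θ a' b).comp (Pi.evalMonoidHom D a')) (Pi.mulSingle a y)) (x b) = _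
  congr 2
  rw [MonoidHom.finsetProd_apply, Finset.prod_eq_single a]
  · simp
  · intro a' _ h
    simp [Pi.mulSingle_eq_of_ne h]
  · simp

theorem diagonalAction_apply_mulSingle [Fintype A] [DecidableEq B]
    (α : ∀ b, U b →* MulAut (C b)) (θ : ∀ a b, D a →* U b) (h : ∀ a, D a) (b : B) (x : C b) :
    ∃ x', diagonalAction α θ h (Pi.mulSingle b x) = Pi.mulSingle b x' := by
  refine ⟨diagonalAction α θ h (Pi.mulSingle b x) b, ?_⟩
  funext b'
  rcases eq_or_ne b' b with rfl | hb
  · simp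
  · rw [Pi.mulSingle_eq_of_ne hb]
    change α b' _ (Pi.mulSingle b x b') = 1
    rw [Pi.mulSingle_eq_of_ne hb, map_one]

variable [Finite B] [∀ b, Finite (C b)] [∀ a, Finite (D a)]

instance {H : Type u} {N : Type v} [Group H] [Group N] [Finite H] [Finite N] (φ : H →* MulAut N) :
    Finite (N ⋊[φ] H) :=
  Finite.of_equiv _ SemidirectProduct.equivProd.symm

variable [Fintype A] (α : ∀ b, U b →* MulAut (C b)) (θ : ∀ a b, D a →* U b)

theorem index_ker_rightHom {H : Type u} {N : Type v} [Group H] [Group N] (φ : H →* MulAut N) :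
    (rightHom : N ⋊[φ] H →* H).ker.index = Nat.card H := by
  rw [Subgroup.index_ker, MonoidHom.range_eq_top.2 rightHom_surjective, Subgroup.card_top]

theorem isNilpotent_ker_rightHom {H : Type u} {N : Type v} [Group H] [Group N]
    [Group.IsNilpotent N] (φ : H →* MulAut N) :
    Group.IsNilpotent (rightHom : N ⋊[φ] H →* H).ker := by
  rw [← range_inl_eq_ker_rightHom]
  exact Group.nilpotent_of_surjective inl.rangeRestrict inl.rangeRestrict_surjective

theorem isNilpotent_quotient_ker_rightHom {H : Type u} {N : Type v} [Group H] [Group N]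
    [Group.IsNilpotent H] (φ : H →* MulAut N) :
    Group.IsNilpotent ((N ⋊[φ] H) ⧸ (rightHom : N ⋊[φ] H →* H).ker) :=
  Group.nilpotent_of_mulEquiv
    (QuotientGroup.quotientKerEquivOfSurjective _ rightHom_surjective).symm

/-- The preimage `M` of `D a` is normal since the top group is abelian, and Hall since the order is
square-free. As `D a` centralizes `C b`, the coordinates give a homomorphism from `M` onto the
abelian group `C b × D a`. -/
theorem exists_mem_codegrees_of_trivial_action
    (hsq : Squarefree (Nat.card ((∀ b, C b) ⋊[diagonalAction α θ] (∀ a, D a))))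
    {a : A} {b : B} (hab : θ a b = 1) (hC : (Nat.card (C b)).Prime)
    (hD : (Nat.card (D a)).Prime) :
    ∃ n ∈ codegrees ((∀ b, C b) ⋊[diagonalAction α θ] (∀ a, D a)),
      Nat.card (D a) ∣ n ∧ Nat.card (C b) ∣ n := by
  classical
  let K : Subgroup (∀ a, D a) := (MonoidHom.mulSingle D a).range
  let M : Subgroup ((∀ b, C b) ⋊[diagonalAction α θ] (∀ a, D a)) := K.comap rightHom
  have hM : (Nat.card M).Coprime M.index := by
    rw [← M.card_mul_index] at hsq
    exact (Nat.squarefree_mul_iff.1 hsq).1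
  let f : M →* C b × D a :=
    { toFun := fun s => (s.1.left b, s.1.right a)
      map_one' := rfl
      map_mul' := by
        rintro ⟨s, y, hy⟩ ⟨t, _⟩
        refine Prod.ext ?_ rfl
        change s.left b * diagonalAction α θ s.right t.left b = s.left b * t.left b
        have hy' : s.right = Pi.mulSingle a y := hy.symm
        rw [hy', diagonalAction_mulSingle_apply, hab]
        simp }
  have hf : Function.Surjective f := by
    rintro ⟨x, y⟩
    refine ⟨⟨⟨Pi.mulSingle b x, Pi.mulSingle a y⟩, y, rfl⟩, ?_⟩
    refine Prod.ext ?_ ?_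
    · exact Pi.mulSingle_eq_same b x
    · exact Pi.mulSingle_eq_same a y
  refine exists_mem_codegrees_of_nilpotent_quotient_of_hall M hM hf hD hC ?_ ?_
  · rw [Nat.card_prod]; exact dvd_mul_left _ _
  · rw [Nat.card_prod]; exact dvd_mul_right _ _

theorem not_dvd_of_mem_codegrees_of_fixedPointFree
    (hsq : Squarefree (Nat.card ((∀ b, C b) ⋊[diagonalAction α θ] (∀ a, D a))))
    {a : A} {b : B} (hab : ∀ y : D a, y ≠ 1 → ∀ x, α b (θ a b y) x = x → x = 1)
    (hC : (Nat.card (C b)).Prime) (hD : (Nat.card (D a)).Prime) {n : ℕ}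
    (hn : n ∈ codegrees ((∀ b, C b) ⋊[diagonalAction α θ] (∀ a, D a)))
    (ha : Nat.card (D a) ∣ n) : ¬ Nat.card (C b) ∣ n := by
  classical
  let i : C b →* (∀ b, C b) ⋊[diagonalAction α θ] (∀ a, D a) := inl.comp (MonoidHom.mulSingle C b)
  let j : D a →* (∀ b, C b) ⋊[diagonalAction α θ] (∀ a, D a) := inr.comp (MonoidHom.mulSingle D a)
  have hi : Function.Injective i := inl_injective.comp (Pi.mulSingle_injective b)
  have hj : Function.Injective j := inr_injective.comp (Pi.mulSingle_injective a)
  have hic : Nat.card i.range = Nat.card (C b) :=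
    (Nat.card_congr (MonoidHom.ofInjective hi).toEquiv).symm
  have hjc : Nat.card j.range = Nat.card (D a) :=
    (Nat.card_congr (MonoidHom.ofInjective hj).toEquiv).symm
  have hnormal : i.range.Normal := by
    refine ⟨?_⟩
    rintro _ ⟨x, rfl⟩ s
    obtain ⟨x', hx'⟩ := diagonalAction_apply_mulSingle α θ s.right b x
    refine ⟨x', ?_⟩
    change inl (Pi.mulSingle b x') = s * inl (Pi.mulSingle b x) * s⁻¹
    have h1 : (inr s.right * inl (Pi.mulSingle b x) * inr s.right⁻¹ :
        (∀ b, C b) ⋊[diagonalAction α θ] (∀ a, D a)) = inl (Pi.mulSingle b x') := by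
      rw [← inl_aut, hx']
    calc inl (Pi.mulSingle b x')
        = inl s.left * inl (Pi.mulSingle b x') * inl s.left⁻¹ := by
          rw [← map_mul, ← map_mul, mul_comm s.left, mul_inv_cancel_right]
      _ = (inl s.left * inr s.right) * inl (Pi.mulSingle b x) *
            (inl s.left * inr s.right)⁻¹ := by
          rw [← h1, mul_inv_rev, map_inv, map_inv]
          simp only [mul_assoc]
      _ = _ := by rw [inl_left_mul_inr_right]
  rw [← hjc] at ha
  rw [← hic]
  refine not_dvd_of_mem_codegrees_of_commute_imp_eq_one hsq j.range i.range
    (hjc ▸ hD) (hic ▸ hC) ?_ hn ha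
  rintro _ ⟨y, rfl⟩ hy _ ⟨x, rfl⟩ hxy
  have hy1 : y ≠ 1 := fun h => hy (by rw [h, map_one])
  have h1 := congrFun (congrArg SemidirectProduct.left hxy) b
  have h2 : α b (θ a b y) x = x := by
    simpa [i, j, diagonalAction_mulSingle_apply] using h1
  rw [hab y hy1 x h2, map_one]

end DiagonalAction

/-! ### Realizing a graph by a group of square-free order -/

section Realization

open SemidirectProduct

theorem MulAut.eq_one_of_apply_eq_self {C : Type u} [Group C] (hC : (Nat.card C).Prime)
    {σ : MulAut C} (hσ : σ ≠ 1) {x : C} (hx : σ x = x) : x = 1 := by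
  have : Fact (Nat.card C).Prime := ⟨hC⟩
  rcases (MonoidHom.eqLocus σ.toMonoidHom (MonoidHom.id C)).eq_bot_or_eq_top_of_prime_card with h | h
  · have : x ∈ MonoidHom.eqLocus σ.toMonoidHom (MonoidHom.id C) := hx
    rwa [h, Subgroup.mem_bot] at this
  · refine absurd (MulEquiv.ext fun y => ?_) hσ
    have : y ∈ MonoidHom.eqLocus σ.toMonoidHom (MonoidHom.id C) := h ▸ Subgroup.mem_top y
    exact this

/-- The congruence lets `D` embed in the automorphism group of `C`, and a nontrivial automorphism of
a group of prime order fixes only the identity. -/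
theorem exists_fixedPointFree_hom {C : Type u} {D : Type v} [CommGroup C] [CommGroup D]
    [IsCyclic C] (hC : (Nat.card C).Prime) (hD : (Nat.card D).Prime)
    (h : Nat.card C ≡ 1 [MOD Nat.card D]) :
    ∃ θ : D →* (ZMod (Nat.card C))ˣ, ∀ y, y ≠ 1 → ∀ x,
      (IsCyclic.mulAutMulEquiv C).symm (θ y) x = x → x = 1 := by
  have : Fact (Nat.card C).Prime := ⟨hC⟩
  have : Fact (Nat.card D).Prime := ⟨hD⟩
  have hdvd : Nat.card D ∣ Nat.card (ZMod (Nat.card C))ˣ := by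
    rw [Nat.card_eq_fintype_card (α := (ZMod (Nat.card C))ˣ), ZMod.card_units]
    exact (Nat.modEq_iff_dvd' hC.one_lt.le).1 h.symm
  obtain ⟨g, hg⟩ := exists_prime_orderOf_dvd_card' (Nat.card D) hdvd
  let e : D ≃* Subgroup.zpowers g :=
    mulEquivOfPrimeCardEq (p := Nat.card D) rfl (by rw [Nat.card_zpowers, hg])
  refine ⟨(Subgroup.zpowers g).subtype.comp e.toMonoidHom, fun y hy x hx => ?_⟩
  refine MulAut.eq_one_of_apply_eq_self hC (fun h => hy ?_) hx
  have h1 := (MulEquiv.map_eq_one_iff _).1 h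
  exact (MulEquiv.map_eq_one_iff e).1 (Subtype.ext h1)

/-- Vertices can be assigned distinct primes such that, modulo the prime of any vertex with `c`, all
primes of vertices without `c` are congruent to `1`. -/
theorem exists_injective_primes_modEq_one {W : Type u} [Finite W] (c : W → Prop) :
    ∃ r : W → ℕ, Function.Injective r ∧ (∀ w, (r w).Prime) ∧
      ∀ v w, c v → ¬ c w → r w ≡ 1 [MOD r v] := by
  classical
  have := Fintype.ofFinite W
  obtain ⟨n, ⟨e⟩⟩ := Finite.exists_equiv_fin W
  let p : W → ℕ := fun w => Nat.nth Nat.Prime (e w)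
  have hp : ∀ w, (p w).Prime := fun w => Nat.prime_nth_prime _
  have hpinj : Function.Injective p := fun v w h =>
    e.injective (Fin.ext (Nat.nth_injective Nat.infinite_setOfPred_prime h))
  -- Vertices with `c` keep the small primes `p w`; the others receive primes congruent to 1 modulo
  -- the product of all `p w`, of which there are infinitely many. Such a prime is never some `p v`,
  -- being 1 modulo `p v`.
  have hK : ∏ w, p w ≠ 0 := Finset.prod_ne_zero_iff.2 fun w _ => (hp w).ne_zero
  let ι := (Nat.infinite_setOfPred_prime_modEq_one hK).natEmbedding
  have hι : ∀ k v, (ι k : ℕ) ≡ 1 [MOD p v] := fun k v =>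
    (ι k).2.2.of_dvd (Finset.dvd_prod_of_mem p (Finset.mem_univ v))
  have hne : ∀ k v, (ι k : ℕ) ≠ p v := fun k v h => by
    have h1 := hι k v
    rw [h] at h1
    exact (hp v).one_lt.ne' (Nat.dvd_one.1 ((Nat.modEq_zero_iff_dvd.1 (h1.symm.trans (by
      simp [Nat.ModEq])))))
  refine ⟨fun w => if c w then p w else ι (e w), fun v w h => ?_, fun w => ?_, fun v w hv hw => ?_⟩
  · by_cases hv : c v <;> by_cases hw : c w <;> simp only [hv, hw, if_true, if_false] at h
    · exact hpinj h
    · exact absurd h.symm (hne _ _)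
    · exact absurd h (hne _ _)
    · exact e.injective (Fin.ext (ι.injective (Subtype.ext h)))
  · by_cases hw : c w <;> simp only [hw, if_true, if_false]
    · exact hp w
    · exact (ι (e w)).2.1
  · simp only [hv, hw, if_true, if_false]
    exact hι _ _

theorem exists_iso_codegreePrimeGraph_of_labelling {W : Type w} (F : SimpleGraph W) {G : Type u}
    [Group G] (r : W → ℕ) (hr : Function.Injective r) (hprime : ∀ w, (r w).Prime)
    (hdvd : ∀ p : ℕ, p.Prime → p ∣ Nat.card G → ∃ w, r w = p)
    (hvertex : ∀ w, ∃ n ∈ codegrees G, r w ∣ n)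
    (hadj : ∀ v w, v ≠ w → (F.Adj v w ↔ ∃ n ∈ codegrees G, r v ∣ n ∧ r w ∣ n)) :
    Nonempty (F ≃g codegreePrimeGraph G) := by
  let f : W → CodegreePrime G := fun w => ⟨r w, hprime w, hvertex w⟩
  have hf : Function.Bijective f := by
    refine ⟨fun v w h => hr (congrArg Subtype.val h), ?_⟩
    rintro ⟨p, hp, n, hn, hpn⟩
    obtain ⟨w, rfl⟩ := hdvd p hp (hpn.trans (dvd_card_of_mem_codegrees hn))
    exact ⟨w, rfl⟩
  refine ⟨⟨Equiv.ofBijective f hf, ?_⟩⟩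
  intro v w
  constructor
  · rintro ⟨hne, n, hn, h⟩
    have hvw : v ≠ w := fun e => hne (congrArg f e)
    exact (hadj v w hvw).2 ⟨n, hn, (dvd_mul_right _ _).trans h, (dvd_mul_left _ _).trans h⟩
  · intro h
    exact codegreePrimeGraph_adj_of_dvd (fun e => h.ne (hf.1 e)) ((hadj v w h.ne).1 h)

/-- The conclusion speaks of a prime labelling and of `codegrees` rather than of a graph
isomorphism, so that it transfers to an isomorphic group in another universe by rewriting. -/
theorem exists_squarefree_group_of_compl_isBipartite {W : Type} [Finite W] (F : SimpleGraph W)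
    (hF : Fᶜ.IsBipartite) : ∃ (G : Type) (_ : Group G) (_ : Finite G),
      Squarefree (Nat.card G) ∧ ∃ r : W → ℕ, Function.Injective r ∧ (∀ w, (r w).Prime) ∧
        (∀ p : ℕ, p.Prime → p ∣ Nat.card G → ∃ w, r w = p) ∧
        (∀ w, ∃ n ∈ codegrees G, r w ∣ n) ∧
        ∀ v w, v ≠ w → (F.Adj v w ↔ ∃ n ∈ codegrees G, r v ∣ n ∧ r w ∣ n) := by
  classical
  have := Fintype.ofFinite W
  obtain ⟨col⟩ := hF
  let c : W → Prop := fun w => col w = 0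
  have hcol : ∀ v w, v ≠ w → (c v ↔ c w) → F.Adj v w := by
    intro v w hne hvw
    by_contra h
    have h1 : col v ≠ col w := col.valid ((SimpleGraph.compl_adj _ _ _).2 ⟨hne, h⟩)
    simp only [c] at hvw
    omega
  obtain ⟨r, hr, hprime, hmod⟩ := exists_injective_primes_modEq_one c
  have hfact : ∀ w, Fact (r w).Prime := fun w => ⟨hprime w⟩
  let A := {w // c w}
  let B := {w // ¬ c w}
  let C : B → Type := fun b => Multiplicative (ZMod (r b))
  let D : A → Type := fun a => Multiplicative (ZMod (r a))
  let : ∀ b, CommGroup (C b) := fun b => inferInstanceAs (CommGroup (Multiplicative (ZMod (r b))))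
  let : ∀ a, CommGroup (D a) := fun a => inferInstanceAs (CommGroup (Multiplicative (ZMod (r a))))
  have hC : ∀ b, Nat.card (C b) = r b := fun b => Nat.card_zmod _
  have hD : ∀ a, Nat.card (D a) = r a := fun a => Nat.card_zmod _
  have hCp : ∀ b, (Nat.card (C b)).Prime := fun b => (hC b).symm ▸ hprime _
  have hDp : ∀ a, (Nat.card (D a)).Prime := fun a => (hD a).symm ▸ hprime _
  have : ∀ b, Finite (C b) := fun b => Nat.finite_of_card_ne_zero (hCp b).ne_zero
  have : ∀ a, Finite (D a) := fun a => Nat.finite_of_card_ne_zero (hDp a).ne_zero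
  have : ∀ b, IsCyclic (C b) := fun b => inferInstanceAs (IsCyclic (Multiplicative (ZMod (r b))))
  let α : ∀ b, (ZMod (Nat.card (C b)))ˣ →* MulAut (C b) := fun b =>
    (IsCyclic.mulAutMulEquiv (C b)).symm.toMonoidHom
  have hθ : ∀ a b, ∃ θ : D a →* (ZMod (Nat.card (C b)))ˣ,
      (F.Adj a b → θ = 1) ∧ (¬ F.Adj a b → ∀ y, y ≠ 1 → ∀ x, α b (θ y) x = x → x = 1) := by
    -- Nonadjacent vertices of different colours get a faithful action, available by the congruence
    -- between their primes.
    intro a b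
    by_cases hab : F.Adj a b
    · exact ⟨1, fun _ => rfl, fun h => absurd hab h⟩
    · obtain ⟨θ, h⟩ := exists_fixedPointFree_hom (hCp b) (hDp a)
        (by rw [hC, hD]; exact hmod a b a.2 b.2)
      exact ⟨θ, fun h => absurd h hab, fun _ => h⟩
  choose θ hθ1 hθ2 using hθ
  let G := (∀ b, C b) ⋊[diagonalAction α θ] (∀ a, D a)
  have hcardG : Nat.card G = ∏ w, r w := by
    rw [SemidirectProduct.card, Nat.card_pi, Nat.card_pi,
      ← Fintype.prod_subtype_mul_prod_subtype c r, mul_comm]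
    simp only [hC, hD]
    rfl
  have hsq : Squarefree (Nat.card G) := by
    rw [hcardG]
    refine Finset.squarefree_prod_of_pairwise_isCoprime ?_ fun w _ => (hprime w).squarefree
    intro v _ w _ hvw
    exact Nat.coprime_iff_isRelPrime.1 ((Nat.coprime_primes (hprime v) (hprime w)).2 (hr.ne hvw))
  let N : Subgroup G := (rightHom : G →* ∀ a, D a).ker
  have hNnil : Group.IsNilpotent N := isNilpotent_ker_rightHom _
  have hNquot : Group.IsNilpotent (G ⧸ N) := isNilpotent_quotient_ker_rightHom _
  have hNindex : N.index = ∏ a : A, r a := by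
    rw [index_ker_rightHom, Nat.card_pi]
    simp only [hD]
  have hrG : ∀ w, r w ∣ Nat.card G := fun w =>
    hcardG ▸ Finset.dvd_prod_of_mem r (Finset.mem_univ w)
  have hrN : ∀ w, r w ∣ N.index ↔ c w := by
    intro w
    rw [hNindex, (hprime w).prime.dvd_finsetProd_iff]
    constructor
    · rintro ⟨a, -, h⟩
      have : w = a := hr ((Nat.prime_dvd_prime_iff_eq (hprime _) (hprime _)).1 h)
      exact this ▸ a.2
    · exact fun h => ⟨⟨w, h⟩, Finset.mem_univ _, dvd_rfl⟩
  have hsame : ∀ v w, (c v ↔ c w) → ∃ n ∈ codegrees G, r v ∣ n ∧ r w ∣ n := by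
    intro v w h
    by_cases hv : c v
    · exact exists_mem_codegrees_of_dvd_index N (hprime v) (hprime w) ((hrN v).2 hv)
        ((hrN w).2 (h.1 hv))
    · exact exists_mem_codegrees_of_not_dvd_index N (hprime v) (hprime w) (hrG v) (hrG w)
        (fun hd => hv ((hrN v).1 hd)) (fun hd => hv (h.2 ((hrN w).1 hd)))
  have hcross : ∀ v w, c v → ¬ c w → (F.Adj v w ↔ ∃ n ∈ codegrees G, r v ∣ n ∧ r w ∣ n) := by
    intro v w hv hw
    constructor
    · intro h
      have := exists_mem_codegrees_of_trivial_action α θ hsq (hθ1 ⟨v, hv⟩ ⟨w, hw⟩ h)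
        (hCp ⟨w, hw⟩) (hDp ⟨v, hv⟩)
      rwa [hC, hD] at this
    · rintro ⟨n, hn, hvn, hwn⟩
      by_contra h
      refine not_dvd_of_mem_codegrees_of_fixedPointFree α θ hsq (hθ2 ⟨v, hv⟩ ⟨w, hw⟩ h)
        (hCp ⟨w, hw⟩) (hDp ⟨v, hv⟩) hn ?_ ?_
      · rwa [hD]
      · rwa [hC]
  refine ⟨G, inferInstance, inferInstance, hsq, r, hr, hprime, fun p hp hpG => ?_, fun w => ?_,
    fun v w hvw => ?_⟩
  · rw [hcardG, hp.prime.dvd_finsetProd_iff] at hpG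
    obtain ⟨w, -, h⟩ := hpG
    exact ⟨w, ((Nat.prime_dvd_prime_iff_eq hp (hprime w)).1 h).symm⟩
  · obtain ⟨n, hn, h, -⟩ := hsame w w Iff.rfl
    exact ⟨n, hn, h⟩
  · by_cases hv : c v <;> by_cases hw : c w
    · exact ⟨fun _ => hsame v w (by simp [hv, hw]), fun _ => hcol v w hvw (by simp [hv, hw])⟩
    · exact hcross v w hv hw
    · rw [F.adj_comm, hcross w v hw hv]
      simp only [and_comm]
    · exact ⟨fun _ => hsame v w (by simp [hv, hw]), fun _ => hcol v w hvw (by simp [hv, hw])⟩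

end Realization

/-! ### The equivalence -/

theorem SimpleGraph.Iso.isBipartite_compl {V : Type v} {W : Type w} {F : SimpleGraph V}
    {F' : SimpleGraph W} (e : F ≃g F') (h : F'ᶜ.IsBipartite) : Fᶜ.IsBipartite := by
  obtain ⟨c⟩ := h
  refine ⟨SimpleGraph.Coloring.mk (fun v => c (e v)) fun {a b} hab => c.valid ?_⟩
  rw [SimpleGraph.compl_adj] at hab ⊢
  exact ⟨fun h => hab.1 (e.injective h), fun h => hab.2 (e.map_adj_iff.1 h)⟩

theorem proposition3p6
    (C : (G : Type u) → [Group G] → [Finite G] → Prop)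
    (hsquarefree : ∀ (G : Type u) [Group G] [Finite G], Squarefree (Nat.card G) → C G)
    (hmetanilpotent : ∀ (G : Type u) [Group G] [Finite G], C G → IsMetanilpotent G)
    {W : Type v} [Finite W] (F : SimpleGraph W) :
    (∃ (G : Type u) (_ : Group G) (_ : Finite G),
      C G ∧ Nonempty (F ≃g codegreePrimeGraph G)) ↔ Fᶜ.IsBipartite := by
  constructor
  · rintro ⟨G, _, _, hG, ⟨e⟩⟩
    exact e.isBipartite_compl (compl_codegreePrimeGraph_isBipartite (hmetanilpotent G hG))
  · intro hF
    -- The group is built over a vertex set in `Type`, so `F` is first moved to `Fin n`, and the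
    -- group is then lifted to universe `u`.
    obtain ⟨n, ⟨e⟩⟩ := Finite.exists_equiv_fin W
    let F' : SimpleGraph (Fin n) := F.comap e.symm
    let i : F' ≃g F := SimpleGraph.Iso.comap e.symm F
    obtain ⟨G, _, _, hsq, r, hr, hprime, hdvd, hvertex, hadj⟩ :=
      exists_squarefree_group_of_compl_isBipartite F' (i.isBipartite_compl hF)
    have hcard : Nat.card (ULift.{u} G) = Nat.card G := Nat.card_congr Equiv.ulift
    have hcod : codegrees (ULift.{u} G) = codegrees G := codegrees_eq_of_mulEquiv MulEquiv.ulift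
    rw [← hcard] at hsq hdvd
    rw [← hcod] at hvertex hadj
    obtain ⟨j⟩ := exists_iso_codegreePrimeGraph_of_labelling F' r hr hprime hdvd hvertex hadj
    exact ⟨ULift.{u} G, inferInstance, inferInstance, hsquarefree _ hsq, ⟨i.symm.trans j⟩⟩
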